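/- Let $p$ be a prime number and let $X$ be a Noetherian normal integral $\mathbb{F}_p$-scheme with function field $K(X)$ and generic point $\eta\colon \operatorname{Spec} K(X)\to X$. For an $\mathbb{F}_p$-scheme $Y$ with absolute Frobenius $F_Y\colon Y\to Y$ (the identity on points and $a\mapsto a^p$ on functions), an $F$-divided line bundle on $Y$ is a sequence $\{L_i,\sigma_i\}_{i\ge 0}$ of line bundles $L_i$ on $Y$ with isomorphisms $\sigma_i\colon F_Y^*L_{i+1}\to L_i$ of $\mathcal{O}_Y$-modules; a morphism $\{L_i,\sigma_i\}\to\{L'_i,\sigma'_i\}$ is a sequence of $\mathcal{O}_Y$-linear maps $\alpha_i\colon L_i\to L'_i$ such that $\sigma'_i\circ F_Y^*(\alpha_{i+1})=\alpha_i\circ\sigma_i$ for all $i$. Let $\operatorname{Pic}_F(Y)$ denote the group of isomorphism classes of $F$-divided line bundles on $Y$; a morphism $f\colon Y'\to Y$ of $\mathbb{F}_p$-schemes induces, by pull-back of the $L_i$ and $\sigma_i$ along $f$ (using $F_Y\circ f=f\circ F_{Y'}$), a restriction map $\operatorname{Pic}_F(Y)\to\operatorname{Pic}_F(Y')$. Then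 the restriction map $$\operatorname{Pic}_F(X)\to\operatorname{Pic}_F(\eta):=\operatorname{Pic}_F(\operatorname{Spec}K(X))$$ is injective. In particular, for every non-empty open subset $U\subset X$, the restriction map $\operatorname{Pic}_F(X)\to\operatorname{Pic}_F(U)$ is injective. -/

import Mathlib

universe u

open CategoryTheory AlgebraicGeometry TopologicalSpace Opposite

noncomputable section

namespace FDiv

/-- `X` is an `𝔽_p`-scheme: `p = 0` in the ring of global functions, which is the same as the
existence of a (necessarily unique) morphism from `X` to the spectrum of `𝔽_p`. -/
class IsFpScheme (p : ℕ) (X : Scheme.{u}) : Prop where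
  natCast_eq_zero : (p : Γ(X, ⊤)) = 0

theorem isFpScheme_iff (p : ℕ) (X : Scheme.{u}) :
    IsFpScheme p X ↔ Nonempty (X ⟶ Spec (CommRingCat.of (ULift.{u} (ZMod p)))) := by
  constructor
  · rintro ⟨h⟩
    have : CharP Γ(X, ⊤) (ringChar Γ(X, ⊤)) := ringChar.charP _
    have hd : ringChar Γ(X, ⊤) ∣ p := (CharP.cast_eq_zero_iff _ _ p).1 h
    exact ⟨X.toSpecΓ ≫ Spec.map (CommRingCat.ofHom
      ((ZMod.castHom hd Γ(X, ⊤)).comp (ULift.ringEquiv (R := ZMod p)).toRingHom))⟩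
  · rintro ⟨f⟩
    have h0 : (p : ULift.{u} (ZMod p)) = 0 := by
      apply ULift.ext
      simp
    have h := congrArg ((Scheme.ΓSpecIso (CommRingCat.of (ULift.{u} (ZMod p)))).inv ≫
      f.appTop).hom h0
    rw [map_natCast, map_zero] at h
    exact ⟨h⟩

theorem IsFpScheme.of_hom (p : ℕ) {X Y : Scheme.{u}} (f : Y ⟶ X) [hX : IsFpScheme p X] :
    IsFpScheme p Y := by
  have h := congrArg f.appTop.hom hX.natCast_eq_zero
  rw [map_natCast, map_zero] at h
  exact ⟨h⟩

theorem natCast_section_eq_zero (p : ℕ) (X : Scheme.{u}) [hX : IsFpScheme p X] (U : X.Opens) :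
    (p : Γ(X, U)) = 0 := by
  have h := congrArg (X.presheaf.map (homOfLE (le_top : U ≤ ⊤)).op).hom hX.natCast_eq_zero
  rwa [map_natCast, map_zero] at h

instance (p : ℕ) (X : Scheme.{u}) [IsFpScheme p X] (U : X.Opens) :
    IsFpScheme p (U : Scheme.{u}) := .of_hom p U.ι

instance (p : ℕ) (X : Scheme.{u}) [IsFpScheme p X] (x : X) :
    IsFpScheme p (Spec (X.presheaf.stalk x)) := .of_hom p (X.fromSpecStalk x)

/-- The `p`-th power map of a commutative ring in which the prime number `p` is zero.
(The zero ring is allowed.) -/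
def powHom (p : ℕ) [hp : Fact p.Prime] (R : Type u) [CommRing R] (h : (p : R) = 0) : R →+* R where
  toFun a := a ^ p
  map_one' := one_pow p
  map_mul' a b := mul_pow a b p
  map_zero' := zero_pow hp.out.ne_zero
  map_add' a b := by
    obtain ⟨r, hr⟩ := exists_add_pow_prime_eq hp.out a b
    rw [hr, h]
    ring

variable (p : ℕ) [hp : Fact p.Prime]

/-- The absolute Frobenius as a morphism of ringed spaces: the identity on points and
`a ↦ a ^ p` on functions. -/
def frobeniusPresheafedSpaceHom (X : Scheme.{u}) [IsFpScheme p X] :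
    X.toPresheafedSpace.Hom X.toPresheafedSpace where
  base := 𝟙 _
  c :=
    { app U := CommRingCat.ofHom
        (powHom p Γ(X, U.unop) (natCast_section_eq_zero p X U.unop))
      naturality U V i := by
        ext a
        exact (map_pow (X.presheaf.map i).hom a p).symm }

/-- The absolute Frobenius endomorphism `F_X` of an `𝔽_p`-scheme `X`. -/
def absoluteFrobenius (X : Scheme.{u}) [IsFpScheme p X] : X ⟶ X where
  __ := frobeniusPresheafedSpaceHom p X
  prop x := by
    constructor
    intro a ha
    obtain ⟨U, hxU, s, rfl⟩ := X.presheaf.exists_germ_eq (x := x) a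
    have h1 : ((frobeniusPresheafedSpaceHom p X).stalkMap x).hom (X.presheaf.germ U x hxU s) =
        (X.presheaf.germ U x hxU s) ^ p :=
      (PresheafedSpace.stalkMap_germ_apply (frobeniusPresheafedSpaceHom p X) U x hxU s).trans
        (map_pow (X.presheaf.germ U x hxU).hom s p)
    have h2 : IsUnit ((X.presheaf.germ U x hxU s) ^ p) := h1 ▸ ha
    exact (isUnit_pow_iff hp.out.ne_zero).1 h2

theorem absoluteFrobenius_app (X : Scheme.{u}) [IsFpScheme p X] (U : X.Opens) (a : Γ(X, U)) :
    (absoluteFrobenius p X).app U a = (a ^ p : Γ(X, U)) := rfl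

/-- The absolute Frobenius commutes with all morphisms. -/
theorem comp_absoluteFrobenius {X Y : Scheme.{u}} [IsFpScheme p X] [IsFpScheme p Y] (f : Y ⟶ X) :
    f ≫ absoluteFrobenius p X = absoluteFrobenius p Y ≫ f := by
  refine Scheme.Hom.ext rfl fun U ↦ ?_
  ext a
  have h1 : (f ≫ absoluteFrobenius p X).app U a = (f.app U a) ^ p := map_pow (f.app U).hom a p
  have h2 : (absoluteFrobenius p Y ≫ f).app U a = (f.app U a) ^ p := rfl
  rw [h2]
  exact (congrArg (Y.presheaf.map (𝟙 _)).hom h1).trans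
    (congrArg (fun φ : Γ(Y, f ⁻¹ᵁ U) ⟶ Γ(Y, f ⁻¹ᵁ U) ↦ φ.hom ((f.app U a) ^ p))
      (Y.presheaf.map_id (op (f ⁻¹ᵁ U))))

/-- The structure sheaf as a module over itself. -/
abbrev structureModule (X : Scheme.{u}) : X.Modules := SheafOfModules.unit X.ringCatSheaf

theorem opensMap_final {X Y : TopCat.{u}} (f : X ⟶ Y) : (Opens.map f).Final where
  out V := by
    have ht : Limits.IsTerminal (StructuredArrow.mk (homOfLE le_top : V ⟶ (Opens.map f).obj ⊤)) :=
      Limits.IsTerminal.ofUniqueHom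
        (fun W ↦ StructuredArrow.homMk (homOfLE le_top) (Subsingleton.elim _ _))
        (fun W m ↦ StructuredArrow.hom_ext _ _ (Subsingleton.elim _ _))
    have := ht.hasTerminal
    exact isConnected_of_hasTerminal _

/-- The canonical isomorphism `f^* 𝒪_X ≅ 𝒪_Y`. -/
def pullbackStructureModuleIso {X Y : Scheme.{u}} (f : Y ⟶ X) :
    (Scheme.Modules.pullback f).obj (structureModule X) ≅ structureModule Y :=
  haveI := opensMap_final f.base
  haveI : (SheafOfModules.pushforward.{u} f.toRingCatSheafHom).IsRightAdjoint :=
    (Scheme.Modules.pullbackPushforwardAdjunction f).isRightAdjoint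
  let e := @asIso _ _ _ _ (SheafOfModules.pullbackObjUnitToUnit.{u} f.toRingCatSheafHom)
    (SheafOfModules.instIsIsoPullbackObjUnitToUnitOfFinal f.toRingCatSheafHom)
  { hom := e.hom
    inv := e.inv
    hom_inv_id := e.hom_inv_id
    inv_hom_id := e.inv_hom_id }

/-- A line bundle on `X`: an `𝒪_X`-module which is locally isomorphic to `𝒪_X`. -/
def IsLineBundle {X : Scheme.{u}} (L : X.Modules) : Prop :=
  ∀ x : X, ∃ U : X.Opens, x ∈ U ∧ Nonempty (L.restrict U.ι ≅ structureModule (U : Scheme.{u}))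

theorem IsLineBundle.pullback {X Y : Scheme.{u}} (f : Y ⟶ X) {L : X.Modules}
    (hL : IsLineBundle L) : IsLineBundle ((Scheme.Modules.pullback f).obj L) := by
  intro y
  obtain ⟨U, hyU, ⟨e⟩⟩ := hL (f y)
  refine ⟨f ⁻¹ᵁ U, hyU, ⟨?_⟩⟩
  exact (Scheme.Modules.restrictFunctorIsoPullback (f ⁻¹ᵁ U).ι).app _ ≪≫
    (Scheme.Modules.pullbackComp (f ⁻¹ᵁ U).ι f).app L ≪≫
    (Scheme.Modules.pullbackCongr (f.resLE_comp_ι (U := U) (V := f ⁻¹ᵁ U) le_rfl).symm).app L ≪≫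
    ((Scheme.Modules.pullbackComp (f.resLE U (f ⁻¹ᵁ U) le_rfl) U.ι).app L).symm ≪≫
    (Scheme.Modules.pullback (f.resLE U (f ⁻¹ᵁ U) le_rfl)).mapIso
      (((Scheme.Modules.restrictFunctorIsoPullback U.ι).app L).symm ≪≫ e) ≪≫
    pullbackStructureModuleIso _

/-- An `F`-divided sheaf of modules on `X`: a sequence of `𝒪_X`-modules `E_0, E_1, …` with
isomorphisms `σ_i : F_X^* E_{i+1} ≅ E_i`. -/
structure FDividedModule (X : Scheme.{u}) [IsFpScheme p X] where
  /-- the modules `E_i` -/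
  E : ℕ → X.Modules
  /-- the isomorphisms `σ_i` -/
  σ (i : ℕ) : (Scheme.Modules.pullback (absoluteFrobenius p X)).obj (E (i + 1)) ≅ E i

namespace FDividedModule

variable {p}
variable {X Y : Scheme.{u}} [IsFpScheme p X] [IsFpScheme p Y]

/-- A morphism of `F`-divided sheaves: `𝒪_X`-linear maps `α_i : E_i ⟶ E'_i` with
`σ'_i ∘ F_X^*(α_{i+1}) = α_i ∘ σ_i`. -/
@[ext]
structure Hom (A B : FDividedModule p X) where
  /-- the maps `α_i` -/
  α (i : ℕ) : A.E i ⟶ B.E i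
  comm (i : ℕ) : (Scheme.Modules.pullback (absoluteFrobenius p X)).map (α (i + 1)) ≫ (B.σ i).hom =
    (A.σ i).hom ≫ α i

instance : Category (FDividedModule p X) where
  Hom := Hom
  id A := { α := fun _ ↦ 𝟙 _, comm := fun i ↦ by simp }
  comp f g :=
    { α := fun i ↦ f.α i ≫ g.α i
      comm := fun i ↦ by
        rw [Functor.map_comp, Category.assoc, g.comm, ← Category.assoc, f.comm, Category.assoc] }
  id_comp f := Hom.ext (funext fun i ↦ Category.id_comp (f.α i))
  comp_id f := Hom.ext (funext fun i ↦ Category.comp_id (f.α i))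
  assoc f g h := Hom.ext (funext fun i ↦ Category.assoc (f.α i) (g.α i) (h.α i))

/-- The canonical isomorphism of functors `f^* F_X^* ≅ F_Y^* f^*` coming from
`F_X ∘ f = f ∘ F_Y`. -/
def pullbackFrobeniusIso (f : Y ⟶ X) :
    Scheme.Modules.pullback (absoluteFrobenius p X) ⋙ Scheme.Modules.pullback f ≅
      Scheme.Modules.pullback f ⋙ Scheme.Modules.pullback (absoluteFrobenius p Y) :=
  Scheme.Modules.pullbackComp f (absoluteFrobenius p X) ≪≫
    Scheme.Modules.pullbackCongr (comp_absoluteFrobenius p f) ≪≫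
    (Scheme.Modules.pullbackComp (absoluteFrobenius p Y) f).symm

/-- The pull-back `f^* {E_i, σ_i}` of an `F`-divided sheaf along a morphism of `𝔽_p`-schemes: the
modules are `f^* E_i`, with the isomorphisms `F_Y^* f^* E_{i+1} ≅ f^* F_X^* E_{i+1} ≅ f^* E_i`. -/
def pullback (f : Y ⟶ X) : FDividedModule p X ⥤ FDividedModule p Y where
  obj A :=
    { E := fun i ↦ (Scheme.Modules.pullback f).obj (A.E i)
      σ := fun i ↦ ((pullbackFrobeniusIso f).app (A.E (i + 1))).symm ≪≫
        (Scheme.Modules.pullback f).mapIso (A.σ i) }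
  map {A B} g :=
    { α := fun i ↦ (Scheme.Modules.pullback f).map (g.α i)
      comm := fun i ↦ by
        have h1 := (pullbackFrobeniusIso (p := p) f).inv.naturality (g.α (i + 1))
        have h2 := congrArg (Scheme.Modules.pullback f).map (g.comm i)
        rw [Functor.map_comp, Functor.map_comp] at h2
        dsimp at h1 ⊢
        rw [← Category.assoc, h1, Category.assoc, h2, Category.assoc] }
  map_id A := Hom.ext (funext fun i ↦ (Scheme.Modules.pullback f).map_id (A.E i))
  map_comp g h := Hom.ext (funext fun i ↦ (Scheme.Modules.pullback f).map_comp (g.α i) (h.α i))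

/-- The `F`-divided sheaves all of whose terms are line bundles. -/
def isLineBundle (p : ℕ) [Fact p.Prime] (X : Scheme.{u}) [IsFpScheme p X] :
    ObjectProperty (FDividedModule p X) :=
  fun A ↦ ∀ i, IsLineBundle (A.E i)

end FDividedModule

/-- The category of `F`-divided line bundles on `X`. -/
abbrev FDividedLineBundle (X : Scheme.{u}) [IsFpScheme p X] :=
  (FDividedModule.isLineBundle p X).FullSubcategory

/-- Pull-back of `F`-divided line bundles. -/
def FDividedLineBundle.pullback {X Y : Scheme.{u}} [IsFpScheme p X] [IsFpScheme p Y] (f : Y ⟶ X) :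
    FDividedLineBundle p X ⥤ FDividedLineBundle p Y :=
  (FDividedModule.isLineBundle p Y).lift
    ((FDividedModule.isLineBundle p X).ι ⋙ FDividedModule.pullback f)
    fun A i ↦ (A.property i).pullback f

/-- `Pic_F(X)`: the isomorphism classes of `F`-divided line bundles on `X`. -/
def PicF (X : Scheme.{u}) [IsFpScheme p X] :=
  Quotient (isIsomorphicSetoid (FDividedLineBundle p X))

/-- The map `Pic_F(X) → Pic_F(Y)` given by pull-back along `f : Y ⟶ X`. -/
def PicF.map {X Y : Scheme.{u}} [IsFpScheme p X] [IsFpScheme p Y] (f : Y ⟶ X) :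
    PicF p X → PicF p Y :=
  Quotient.map (FDividedLineBundle.pullback p f).obj
    fun _ _ ⟨e⟩ ↦ ⟨(FDividedLineBundle.pullback p f).mapIso e⟩

/-- A scheme is normal if all its local rings are integrally closed domains. -/
class IsNormalScheme (X : Scheme.{u}) : Prop where
  isDomain_stalk (x : X) : IsDomain (X.presheaf.stalk x)
  isIntegrallyClosed_stalk (x : X) : IsIntegrallyClosed (X.presheaf.stalk x)

/-- The canonical morphism `Spec K(X) ⟶ X` from the generic point of `X`. -/
def genericPointHom (X : Scheme.{u}) [IrreducibleSpace X] : Spec X.functionField ⟶ X :=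
  X.fromSpecStalk (genericPoint X)

end FDiv

end

noncomputable section

namespace FDiv

/-! Let `φ_i` be the components of an isomorphism over `η` between the restrictions of `{L_i, σ_i}`
and `{M_i, τ_i}`. Near a point `x`, with generators of `L_i` and `M_i` chosen, `φ_i` is
multiplication by some `u_i ∈ K(X)ˣ`. As Frobenius pull-back is `p`-linear, compatibility with `σ_i`
and `τ_i` reads `u_i = a_i * u_{i+1} ^ p` with `a_i` a unit of the local ring at `x`
(`IsTransition.exists_unit`). So `u_i` is, up to units, a `p ^ n`-th power for every `n`. In a
discrete valuation ring its valuation is divisible by all `p ^ n`, hence zero; a Noetherian normal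
domain is the intersection of its localizations that are discrete valuation rings, so `u_i` is a
unit at `x` (`exists_unit_of_forall_eq_mul_pow`).

Thus `φ_i` sends local generators to sections defined on `X`. Sections of a line bundle on an
integral scheme embed into the generic fibre, so these images glue to a unique `L_i ⟶ M_i`
(`IsPullbackInjective.exists_pullback_map_eq`). The same applies to the inverses, and uniqueness
transports every identity from `η` to `X`.

Module pull-backs are given by adjunction, without a formula; identities between maps out of them
are tested on pulled-back sections (`pullback_hom_ext`). -/

/-! ### Infinitely divisible elements in normal domains -/

theorem exists_unit_of_forall_eq_mul_pow_of_isDiscreteValuationRing {R K : Type*} [CommRing R]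
    [IsDomain R] [IsDiscreteValuationRing R] [Field K] [Algebra R K] [IsFractionRing R K]
    {p : ℕ} (hp : 1 < p) {x : K} (hx : x ≠ 0)
    (h : ∀ n : ℕ, ∃ (a : Rˣ) (y : K), x = algebraMap R K a * y ^ p ^ n) :
    ∃ a : Rˣ, algebraMap R K a = x := by
  obtain ⟨ϖ, hϖ⟩ := IsDiscreteValuationRing.exists_irreducible R
  have hϖ0 : algebraMap R K ϖ ≠ 0 := by simpa using hϖ.ne_zero
  obtain ⟨k, a, hk⟩ :=
    IsDiscreteValuationRing.exists_units_eq_smul_zpow_of_irreducible hϖ hx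
  have hz : ∀ (m : ℤ) (b : Rˣ), algebraMap R K b = algebraMap R K ϖ ^ m → m = 0 := by
    have key : ∀ (m : ℕ) (b : Rˣ), algebraMap R K b = algebraMap R K ϖ ^ m → m = 0 := by
      intro m b hb
      rw [← map_pow] at hb
      have hb' := IsFractionRing.injective R K hb
      by_contra hm
      exact hϖ.not_isUnit ((isUnit_pow_iff hm).1 (hb' ▸ b.isUnit))
    intro m b hb
    obtain ⟨m, rfl | rfl⟩ := m.eq_nat_or_neg
    · exact_mod_cast key m b (by simpa using hb)
    · have := key m b⁻¹ (by
        have h1 : algebraMap R K b * algebraMap R K (b⁻¹ : Rˣ) = 1 := by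
          rw [← map_mul, Units.mul_inv, map_one]
        rw [hb, zpow_neg, zpow_natCast] at h1
        exact (eq_of_inv_mul_eq_one h1).symm)
      simp [this]
  -- The valuation `k` of `x` will be divisible by `p ^ n`; an `n` with `|k| < p ^ n` then forces `k
  -- = 0`.
  obtain ⟨n, hn⟩ : ∃ n, k.natAbs < p ^ n := ⟨_, Nat.lt_pow_self hp⟩
  obtain ⟨b, y, hy⟩ := h n
  have hy0 : y ≠ 0 := by
    rintro rfl
    rw [zero_pow (pow_ne_zero _ (by omega)), mul_zero] at hy
    exact hx hy
  obtain ⟨l, c, hl⟩ :=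
    IsDiscreteValuationRing.exists_units_eq_smul_zpow_of_irreducible hϖ hy0
  have hlk : k - l * (p ^ n : ℕ) = 0 := by
    refine hz _ (b * c ^ p ^ n * a⁻¹) ?_
    have e : algebraMap R K a * algebraMap R K ϖ ^ k =
        algebraMap R K b * (algebraMap R K c ^ p ^ n * algebraMap R K ϖ ^ (l * (p ^ n : ℕ))) := by
      rw [Units.smul_def, Algebra.smul_def] at hk hl
      rw [← hk, hy, hl, mul_pow, zpow_mul, zpow_natCast]
    have ha : algebraMap R K a * algebraMap R K (a⁻¹ : Rˣ) = 1 := by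
      rw [← map_mul, Units.mul_inv, map_one]
    rw [zpow_sub₀ hϖ0, eq_div_iff (zpow_ne_zero _ hϖ0)]
    rw [Units.val_mul, Units.val_mul, Units.val_pow_eq_pow_val, map_mul, map_mul, map_pow]
    linear_combination (-algebraMap R K (a⁻¹ : Rˣ)) * e + algebraMap R K ϖ ^ k * ha
  have hk0 : k = 0 := by
    have hdvd : ((p ^ n : ℕ) : ℤ) ∣ k := ⟨l, by linarith⟩
    by_contra hk0
    have := Nat.le_of_dvd (Int.natAbs_pos.2 hk0) (Int.natCast_dvd.1 hdvd)
    omega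
  exact ⟨a, by rw [hk, hk0, Units.smul_def, Algebra.smul_def, zpow_zero, mul_one]⟩

/-- An element of the fraction field of a Noetherian integrally closed domain `R` outside `R` is
detected by a localization of `R` that is a discrete valuation ring. -/
theorem exists_prime_isDiscreteValuationRing_of_notMem_range {R K : Type*} [CommRing R] [IsDomain R]
    [IsNoetherianRing R] [IsIntegrallyClosed R] [Field K] [Algebra R K] [IsFractionRing R K]
    {x : K} (hx : x ∉ (algebraMap R K).range) :
    ∃ (P : Ideal R) (_ : P.IsPrime), IsDiscreteValuationRing (Localization.AtPrime P) ∧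
      ∀ s : R, algebraMap R K s * x ∈ (algebraMap R K).range → s ∈ P := by
  let N : Submodule R K := LinearMap.range (Algebra.linearMap R K)
  have hN : ∀ {y : K}, y ∈ N ↔ y ∈ (algebraMap R K).range := Iff.rfl
  -- The denominators of `x` form the annihilator of its class in `K ⧸ R`, which lies in an
  -- associated prime `P`, the annihilator of the class of some `w`.
  obtain ⟨P, hP, hxP⟩ := exists_le_isAssociatedPrime_of_isNoetherianRing R
    (Submodule.Quotient.mk (p := N) x) (by rwa [Ne, Submodule.Quotient.mk_eq_zero])
  rw [isAssociatedPrime_iff] at hP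
  obtain ⟨hPp, w, hw⟩ := hP
  obtain ⟨w, rfl⟩ := Submodule.Quotient.mk_surjective _ w
  have hmem : ∀ (y : K) (r : R), r ∈ (⊥ : Submodule R (K ⧸ N)).colon {Submodule.Quotient.mk y} ↔
      algebraMap R K r * y ∈ (algebraMap R K).range := by
    intro y r
    rw [Submodule.mem_colon_singleton, Submodule.mem_bot, ← Submodule.Quotient.mk_smul,
      Submodule.Quotient.mk_eq_zero, Algebra.smul_def, hN]
  have hPw : ∀ r, r ∈ P ↔ algebraMap R K r * w ∈ (algebraMap R K).range := fun r ↦ by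
    rw [← hmem w r, ← hw]
  have hw0 : w ∉ (algebraMap R K).range := fun h ↦
    hPp.ne_top ((Ideal.eq_top_iff_one P).2 ((hPw 1).2 (by simpa using h)))
  have hPbot : P ≠ ⊥ := by
    rintro rfl
    obtain ⟨a, b, hb, hab⟩ := IsFractionRing.div_surjective (A := R) w
    have hb0 : algebraMap R K b ≠ 0 := by simpa using nonZeroDivisors.ne_zero hb
    have : b ∈ (⊥ : Ideal R) := (hPw b).2 ⟨a, by rw [← hab]; field_simp⟩
    exact nonZeroDivisors.ne_zero hb (by simpa using this)
  -- If `w P ⊆ P`, then `w` is integral, because `P` is nonzero and finitely generated; so `w ∈ R`,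
  -- a contradiction.
  obtain ⟨t, htP, s, hs, hsP⟩ : ∃ t ∈ P, ∃ s, algebraMap R K s = algebraMap R K t * w ∧ s ∉ P := by
    by_contra! hcon
    refine hw0 (IsIntegrallyClosed.isIntegral_iff.1
      (isIntegral_of_smul_mem_submodule (Submodule.map (Algebra.linearMap R K) P) ?_ ?_ w ?_))
    · obtain ⟨a, ha, ha0⟩ := Submodule.exists_mem_ne_zero_of_ne_bot hPbot
      exact (Submodule.ne_bot_iff _).2 ⟨_, ⟨a, ha, rfl⟩, by simpa using ha0⟩
    · exact (IsNoetherian.noetherian P).map _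
    · rintro _ ⟨r, hr, rfl⟩
      obtain ⟨c, hc⟩ := (hPw r).1 hr
      exact ⟨c, hcon r hr c hc, by simp [hc, mul_comm]⟩
  refine ⟨P, hPp, ?_, fun r hr ↦ hxP ((hmem x r).2 hr)⟩
  have ht0 : t ≠ 0 := by
    rintro rfl
    rw [map_zero, zero_mul] at hs
    exact hsP (by simpa using ((map_eq_zero_iff _ (IsFractionRing.injective R K)).1 hs) ▸ P.zero_mem)
  have hnf : ¬ IsField (Localization.AtPrime P) := by
    rw [IsLocalRing.isField_iff_maximalIdeal_eq, ← Localization.AtPrime.map_eq_maximalIdeal]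
    intro h
    have := (Ideal.mem_bot).1 (h ▸ Ideal.mem_map_of_mem (algebraMap R (Localization.AtPrime P)) htP)
    exact ht0 ((map_eq_zero_iff _
      (IsLocalization.injective _ P.primeCompl_le_nonZeroDivisors)).1 this)
  refine ((IsDiscreteValuationRing.TFAE (Localization.AtPrime P) hnf).out 4 0).1 ?_
  refine ⟨algebraMap R _ t, ?_⟩
  rw [← Localization.AtPrime.map_eq_maximalIdeal]
  refine le_antisymm (Ideal.map_le_iff_le_comap.2 fun r hr ↦ ?_)
    ((Ideal.span_singleton_le_iff_mem _).2 (Ideal.mem_map_of_mem _ htP))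
  obtain ⟨c, hc⟩ := (hPw r).1 hr
  -- Since `s` becomes a unit at `P`, this exhibits each `r ∈ P` as a multiple of `t`: the maximal
  -- ideal is principal.
  have hrs : s * r = t * c := IsFractionRing.injective R K (by
    rw [map_mul, map_mul, hs, hc]; ring)
  have hsu : IsUnit (algebraMap R (Localization.AtPrime P) s) :=
    IsLocalization.map_units (M := P.primeCompl) _ ⟨s, hsP⟩
  rw [Ideal.mem_comap, Ideal.submodule_span_eq, Ideal.mem_span_singleton, ← hsu.dvd_mul_left,
    ← map_mul, hrs, map_mul]
  exact dvd_mul_right _ _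

/-- A nonzero element of the fraction field of a Noetherian integrally closed domain which is a
`p ^ n`-th power up to units for all `n` is a unit. -/
theorem exists_unit_of_forall_eq_mul_pow {R K : Type*} [CommRing R] [IsDomain R]
    [IsNoetherianRing R] [IsIntegrallyClosed R] [Field K] [Algebra R K] [IsFractionRing R K]
    {p : ℕ} (hp : 1 < p) {x : K} (hx : x ≠ 0)
    (h : ∀ n : ℕ, ∃ (a : Rˣ) (y : K), x = algebraMap R K a * y ^ p ^ n) :
    ∃ a : Rˣ, algebraMap R K a = x := by
  have key : ∀ x : K, x ≠ 0 → (∀ n : ℕ, ∃ (a : Rˣ) (y : K), x = algebraMap R K a * y ^ p ^ n) →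
      ∃ a : R, algebraMap R K a = x := by
    intro x hx h
    by_contra hxR
    obtain ⟨P, hP, hdvr, hPx⟩ := exists_prime_isDiscreteValuationRing_of_notMem_range hxR
    let _ := IsLocalization.localizationAlgebraOfSubmonoidLe (Localization.AtPrime P) K
      P.primeCompl (nonZeroDivisors R) P.primeCompl_le_nonZeroDivisors
    have := IsLocalization.localization_isScalarTower_of_submonoid_le (Localization.AtPrime P) K
      P.primeCompl (nonZeroDivisors R) P.primeCompl_le_nonZeroDivisors
    have : IsFractionRing (Localization.AtPrime P) K :=
      IsFractionRing.isFractionRing_of_isDomain_of_isLocalization P.primeCompl _ _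
    obtain ⟨a, ha⟩ := exists_unit_of_forall_eq_mul_pow_of_isDiscreteValuationRing
      (R := Localization.AtPrime P) hp hx fun n ↦ by
        obtain ⟨a, y, e⟩ := h n
        exact ⟨a.map (algebraMap R (Localization.AtPrime P)).toMonoidHom, y, by
          rw [e]
          congr 1
          exact IsScalarTower.algebraMap_apply R (Localization.AtPrime P) K a⟩
    -- Writing `x = r / s` with `s ∉ P` contradicts that all denominators of `x` lie in `P`.
    obtain ⟨⟨r, s⟩, hrs⟩ := IsLocalization.surj P.primeCompl (a : Localization.AtPrime P)
    refine s.2 (hPx s ⟨r, ?_⟩)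
    rw [← ha, IsScalarTower.algebraMap_apply R (Localization.AtPrime P) K r, ← hrs, map_mul,
      ← IsScalarTower.algebraMap_apply, mul_comm]
  obtain ⟨a, ha⟩ := key x hx h
  -- The hypothesis is stable under inversion, so `x⁻¹` also lies in `R`.
  obtain ⟨b, hb⟩ := key x⁻¹ (inv_ne_zero hx) fun n ↦ by
    obtain ⟨a, y, e⟩ := h n
    refine ⟨a⁻¹, y⁻¹, ?_⟩
    have ha : algebraMap R K (a⁻¹ : Rˣ) = (algebraMap R K a)⁻¹ := by
      refine eq_inv_of_mul_eq_one_left ?_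
      rw [← map_mul, Units.inv_mul, map_one]
    rw [e, ha, mul_inv, inv_pow]
  have hab : a * b = 1 := IsFractionRing.injective R K (by
    rw [map_mul, ha, hb, mul_inv_cancel₀ hx, map_one])
  exact ⟨Units.mkOfMulEqOne a b hab, ha⟩

/-! ### Morphisms of modules on sections -/

section Hom

variable {X : Scheme.{u}} {M N : X.Modules}

/-- A morphism of modules given by compatible linear maps on sections. -/
def homMk (φ : ∀ U : X.Opens, Γ(M, U) →ₗ[Γ(X, U)] Γ(N, U))
    (hφ : ∀ {U V : X.Opens} (h : V ≤ U) (s : Γ(M, U)),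
      N.presheaf.map (homOfLE h).op (φ U s) = φ V (M.presheaf.map (homOfLE h).op s)) : M ⟶ N where
  val :=
    { app U := ModuleCat.ofHom (φ U.unop)
      naturality {U V} i := by
        ext s
        exact (hφ i.unop.le s).symm }

theorem app_map (φ : M ⟶ N) {U V : X.Opens} (i : V ⟶ U) (s : Γ(M, U)) :
    φ.app V (M.presheaf.map i.op s) = N.presheaf.map i.op (φ.app U s) :=
  ConcreteCategory.congr_hom (φ.mapPresheaf.naturality i.op) s

theorem map_map (M : X.Modules) {U V W : X.Opens} (i : V ⟶ U) (j : W ⟶ V) (k : W ⟶ U)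
    (s : Γ(M, U)) :
    M.presheaf.map j.op (M.presheaf.map i.op s) = M.presheaf.map k.op s := by
  rw [← ConcreteCategory.comp_apply, ← Functor.map_comp]
  rfl

theorem map_self (M : X.Modules) {U : X.Opens} (i : U ⟶ U) (s : Γ(M, U)) :
    M.presheaf.map i.op s = s := by
  have : i.op = 𝟙 _ := rfl
  rw [this, CategoryTheory.Functor.map_id]
  rfl

theorem comp_app_apply {L : X.Modules} (φ : L ⟶ M) (ψ : M ⟶ N) (U : X.Opens) (s : Γ(L, U)) :
    (φ ≫ ψ).app U s = ψ.app U (φ.app U s) := rfl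

theorem inv_app_hom_app_apply {C : Type*} [Category C] {F G : C ⥤ X.Modules} (α : F ≅ G) (L : C)
    (U : X.Opens) (s : Γ(F.obj L, U)) : (α.inv.app L).app U ((α.hom.app L).app U s) = s := by
  rw [← comp_app_apply, Iso.hom_inv_id_app]
  rfl

end Hom

/-! ### Pull-back of sections -/

section PullbackSection

variable {X Y Z : Scheme.{u}}

/-- The pull-back of sections of `L` over `U` to sections of `f^* L` over `f⁻¹ U`. -/
def unitSection (f : Y ⟶ X) (L : X.Modules) (U : X.Opens) :
    Γ(L, U) →+ Γ((Scheme.Modules.pullback f).obj L, f ⁻¹ᵁ U) :=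
  (((Scheme.Modules.pullbackPushforwardAdjunction f).unit.app L).app U).hom

/-- The pull-back of sections of `L` over `U` along `f`, as sections of `f^* L` over any open
subset `V` of `f⁻¹ U`. -/
def pullbackSection (f : Y ⟶ X) {L : X.Modules} {U : X.Opens} {V : Y.Opens} (h : V ≤ f ⁻¹ᵁ U) :
    Γ(L, U) →+ Γ((Scheme.Modules.pullback f).obj L, V) :=
  (((Scheme.Modules.pullback f).obj L).presheaf.map (homOfLE h).op).hom.comp (unitSection f L U)

theorem pullbackSection_apply (f : Y ⟶ X) {L : X.Modules} {U : X.Opens} {V : Y.Opens}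
    (h : V ≤ f ⁻¹ᵁ U) (s : Γ(L, U)) : pullbackSection f h s =
      ((Scheme.Modules.pullback f).obj L).presheaf.map (homOfLE h).op (unitSection f L U s) := rfl

theorem map_pullbackSection (f : Y ⟶ X) {L : X.Modules} {U : X.Opens} {V W : Y.Opens}
    (h : V ≤ f ⁻¹ᵁ U) (i : W ⟶ V) (s : Γ(L, U)) :
    ((Scheme.Modules.pullback f).obj L).presheaf.map i.op (pullbackSection f h s) =
      pullbackSection f (i.le.trans h) s :=
  map_map _ _ _ _ _

theorem pullbackSection_map (f : Y ⟶ X) {L : X.Modules} {U U' : X.Opens} {V : Y.Opens}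
    (i : U' ⟶ U) (h : V ≤ f ⁻¹ᵁ U') (s : Γ(L, U)) :
    pullbackSection f h (L.presheaf.map i.op s) =
      pullbackSection f (h.trans (f.preimage_mono i.le)) s := by
  have e : unitSection f L U' (L.presheaf.map i.op s) =
      ((Scheme.Modules.pullback f).obj L).presheaf.map
        (homOfLE (f.preimage_mono i.le)).op (unitSection f L U s) :=
    app_map ((Scheme.Modules.pullbackPushforwardAdjunction f).unit.app L) i s
  rw [pullbackSection_apply, e]
  exact map_map _ _ _ _ _

theorem pullbackSection_smul (f : Y ⟶ X) {L : X.Modules} {U : X.Opens} {V : Y.Opens}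
    (h : V ≤ f ⁻¹ᵁ U) (r : Γ(X, U)) (s : Γ(L, U)) :
    pullbackSection f h (r • s) = (f.appLE U V h r) • pullbackSection f h s := by
  have e : unitSection f L U (r • s) = f.app U r • unitSection f L U s :=
    Scheme.Modules.Hom.app_smul ((Scheme.Modules.pullbackPushforwardAdjunction f).unit.app L) r s
  rw [pullbackSection_apply, e]
  exact Scheme.Modules.map_smul _ (homOfLE h) (f.app U r) _

theorem pullback_map_app_pullbackSection (f : Y ⟶ X) {L M : X.Modules} (φ : L ⟶ M) {U : X.Opens}
    {V : Y.Opens} (h : V ≤ f ⁻¹ᵁ U) (s : Γ(L, U)) :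
    ((Scheme.Modules.pullback f).map φ).app V (pullbackSection f h s) =
      pullbackSection f h (φ.app U s) := by
  rw [pullbackSection_apply, pullbackSection_apply, app_map]
  congr 1
  have := (Scheme.Modules.pullbackPushforwardAdjunction f).unit.naturality φ
  exact (ConcreteCategory.congr_hom (congrArg (fun ψ ↦ Scheme.Modules.Hom.app ψ U) this) s).symm

/-- Pulled-back sections are the values of the adjunction unit, so they determine the transpose `L ⟶
f_* M`. -/
theorem pullback_hom_ext (f : Y ⟶ X) {L : X.Modules} {M : Y.Modules}
    {φ ψ : (Scheme.Modules.pullback f).obj L ⟶ M}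
    (h : ∀ (U : X.Opens) (s : Γ(L, U)), φ.app (f ⁻¹ᵁ U) (pullbackSection f le_rfl s) =
      ψ.app (f ⁻¹ᵁ U) (pullbackSection f le_rfl s)) : φ = ψ := by
  apply ((Scheme.Modules.pullbackPushforwardAdjunction f).homEquiv _ _).injective
  rw [Adjunction.homEquiv_unit, Adjunction.homEquiv_unit]
  ext U s
  have := h U s
  rw [pullbackSection_apply, map_self] at this
  exact this

/-- The comparison map is conjugate to the comparison of push-forwards, hence compatible with the
adjunction units. -/
theorem pullbackComp_inv_app_pullbackSection (f : Y ⟶ X) (g : Z ⟶ Y) {L : X.Modules} {U : X.Opens}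
    {V : Y.Opens} {W : Z.Opens} (hV : V ≤ f ⁻¹ᵁ U) (hW : W ≤ g ⁻¹ᵁ V)
    (hWU : W ≤ (g ≫ f) ⁻¹ᵁ U) (s : Γ(L, U)) :
    ((Scheme.Modules.pullbackComp g f).inv.app L).app W
      (pullbackSection (g ≫ f) hWU s) =
      pullbackSection g hW (pullbackSection f hV s) := by
  have h := unit_conjugateEquiv
    ((Scheme.Modules.pullbackPushforwardAdjunction f).comp
      (Scheme.Modules.pullbackPushforwardAdjunction g))
    (Scheme.Modules.pullbackPushforwardAdjunction (g ≫ f)) (Scheme.Modules.pullbackComp g f).inv L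
  rw [Scheme.Modules.conjugateEquiv_pullbackComp_inv] at h
  have h' := ConcreteCategory.congr_hom (congrArg (fun ψ ↦ Scheme.Modules.Hom.app ψ U) h) s
  have e : pullbackSection g hW (pullbackSection f hV s) =
      pullbackSection g (hW.trans (g.preimage_mono hV))
        (unitSection f L U s) :=
    pullbackSection_map g (homOfLE hV) hW _
  rw [e, pullbackSection_apply, pullbackSection_apply, app_map]
  refine congrArg _ (h'.symm.trans ?_)
  rw [Adjunction.comp_unit_app]
  rfl

theorem pullbackComp_hom_app_pullbackSection (f : Y ⟶ X) (g : Z ⟶ Y) {L : X.Modules} {U : X.Opens}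
    {V : Y.Opens} {W : Z.Opens} (hV : V ≤ f ⁻¹ᵁ U) (hW : W ≤ g ⁻¹ᵁ V)
    (hWU : W ≤ (g ≫ f) ⁻¹ᵁ U) (s : Γ(L, U)) :
    ((Scheme.Modules.pullbackComp g f).hom.app L).app W
      (pullbackSection g hW (pullbackSection f hV s)) =
      pullbackSection (g ≫ f) hWU s := by
  rw [← pullbackComp_inv_app_pullbackSection f g hV hW hWU, ← ConcreteCategory.comp_apply,
    ← Scheme.Modules.Hom.comp_app, Iso.inv_hom_id_app]
  rfl

theorem pullbackCongr_hom_app_pullbackSection {f g : Y ⟶ X} (hfg : f = g) {L : X.Modules}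
    {U : X.Opens} {V : Y.Opens} (h : V ≤ f ⁻¹ᵁ U) (s : Γ(L, U)) :
    ((Scheme.Modules.pullbackCongr hfg).hom.app L).app V (pullbackSection f h s) =
      pullbackSection g (hfg ▸ h) s := by
  subst hfg
  rfl

end PullbackSection

/-! ### Local generators and their pull-back -/

section Generator

variable {X Y : Scheme.{u}}

/-- A section `e` of `L` over `U` generates `L` freely on `U`. -/
def IsGenerator {L : X.Modules} {U : X.Opens} (e : Γ(L, U)) : Prop :=
  ∀ (V : X.Opens) (h : V ≤ U),
    Function.Bijective fun r : Γ(X, V) ↦ r • L.presheaf.map (homOfLE h).op e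

theorem IsGenerator.map {L : X.Modules} {U V : X.Opens} {e : Γ(L, U)} (he : IsGenerator e)
    (i : V ⟶ U) : IsGenerator (L.presheaf.map i.op e) := fun W h ↦ by
  rw [map_map L i (homOfLE h) (homOfLE (h.trans i.le))]
  exact he W _

theorem bijective_app_of_isIso {L M : X.Modules} (φ : L ⟶ M) [IsIso φ] (U : X.Opens) :
    Function.Bijective (φ.app U) :=
  ConcreteCategory.bijective_of_isIso (φ.app U)

theorem isGenerator_app_iff {L M : X.Modules} (φ : L ⟶ M) [IsIso φ] {U : X.Opens} {e : Γ(L, U)} :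
    IsGenerator (φ.app U e) ↔ IsGenerator e := by
  refine forall₂_congr fun V h ↦ ?_
  rw [← (bijective_app_of_isIso φ V).of_comp_iff']
  refine iff_of_eq (congrArg _ (funext fun r ↦ ?_))
  rw [Function.comp_apply, Scheme.Modules.Hom.app_smul, app_map]

/-- The unit section of the structure sheaf. -/
def oneSection (X : Scheme.{u}) (U : X.Opens) : Γ(structureModule X, U) := (1 : Γ(X, U))

theorem isGenerator_oneSection (U : X.Opens) : IsGenerator (oneSection X U) := by
  intro V h
  have e : (fun r : Γ(X, V) ↦ r • (structureModule X).presheaf.map (homOfLE h).op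
      (oneSection X U)) = fun r : Γ(X, V) ↦ r := by
    funext r
    have : (X.presheaf.map (homOfLE h).op) (1 : Γ(X, U)) = 1 := map_one (X.presheaf.map _).hom
    change r * (X.presheaf.map (homOfLE h).op) (1 : Γ(X, U)) = r
    rw [this, mul_one]
  rw [e]
  exact Function.bijective_id

/-- The morphism from the structure sheaf that sends `1` to a given global section. -/
def homOfSection {L : X.Modules} (e : Γ(L, ⊤)) : structureModule X ⟶ L :=
  homMk (fun U ↦ LinearMap.toSpanSingleton Γ(X, U) Γ(L, U) (L.presheaf.map (homOfLE le_top).op e))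
    fun {U V} h s ↦ by
      refine (Scheme.Modules.map_smul L (homOfLE h) s _).trans ?_
      rw [map_map L (homOfLE le_top) (homOfLE h) (homOfLE le_top)]
      rfl

theorem homOfSection_app {L : X.Modules} (e : Γ(L, ⊤)) (U : X.Opens) (r : Γ(X, U)) :
    (homOfSection e).app U r = r • L.presheaf.map (homOfLE le_top).op e := rfl

theorem IsGenerator.isIso_homOfSection {L : X.Modules} {e : Γ(L, ⊤)} (he : IsGenerator e) :
    IsIso (homOfSection e) := by
  rw [Scheme.Modules.Hom.isIso_iff_isIso_app]
  intro U
  rw [ConcreteCategory.isIso_iff_bijective]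
  exact he U le_top

/-- The transpose of this isomorphism is the ring map `𝒪_X ⟶ f_* 𝒪_Y`, which preserves `1`. -/
theorem pullbackStructureModuleIso_hom_app_pullbackSection (f : Y ⟶ X) (U : X.Opens) (V : Y.Opens)
    (h : V ≤ f ⁻¹ᵁ U) :
    (pullbackStructureModuleIso f).hom.app V (pullbackSection f h (oneSection X U)) =
      oneSection Y V := by
  have := opensMap_final f.base
  have : (SheafOfModules.pushforward.{u} f.toRingCatSheafHom).IsRightAdjoint :=
    (Scheme.Modules.pullbackPushforwardAdjunction f).isRightAdjoint
  have key := SheafOfModules.pullbackPushforwardAdjunction_homEquiv_pullbackObjUnitToUnit.{u}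
    f.toRingCatSheafHom
  rw [Adjunction.homEquiv_unit] at key
  have key' : (pullbackStructureModuleIso f).hom.app (f ⁻¹ᵁ U)
      (unitSection f (structureModule X) U (oneSection X U)) = f.app U (1 : Γ(X, U)) :=
    congrArg (fun ψ : structureModule X ⟶
      (Scheme.Modules.pushforward f).obj (structureModule Y) ↦
        Scheme.Modules.Hom.app ψ U (oneSection X U)) key
  have h1 : f.app U (1 : Γ(X, U)) = 1 := map_one (f.app U).hom
  rw [pullbackSection_apply, app_map, key', h1]
  exact map_one (Y.presheaf.map (homOfLE h).op).hom

/-- A global generator amounts to an isomorphism `𝒪_X ≅ L` with `1 ↦ e`; pulling it back reduces the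
claim to the section `1`. -/
theorem IsGenerator.pullbackSection_top (f : Y ⟶ X) {L : X.Modules} {e : Γ(L, ⊤)}
    (he : IsGenerator e) {V : Y.Opens} (h : V ≤ f ⁻¹ᵁ ⊤) : IsGenerator (pullbackSection f h e) := by
  have := he.isIso_homOfSection
  have e1 : (homOfSection e).app ⊤ (oneSection X ⊤) = e := by
    refine (homOfSection_app e ⊤ (1 : Γ(X, ⊤))).trans ?_
    rw [one_smul, map_self]
  rw [← e1, ← pullback_map_app_pullbackSection, isGenerator_app_iff,
    ← isGenerator_app_iff (pullbackStructureModuleIso f).hom,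
    pullbackStructureModuleIso_hom_app_pullbackSection]
  exact isGenerator_oneSection V

/-- Restriction and pull-back are both left adjoint to push-forward, and the isomorphism between
them respects the units. -/
theorem restrictFunctorIsoPullback_hom_app_map (j : Y ⟶ X) [IsOpenImmersion j] {L : X.Modules}
    {U : X.Opens} {V : Y.Opens} (h : V ≤ j ⁻¹ᵁ U) (h' : j ''ᵁ V ≤ U) (s : Γ(L, U)) :
    ((Scheme.Modules.restrictFunctorIsoPullback j).hom.app L).app V
      ((L.restrictAppIso j V).inv (L.presheaf.map (homOfLE h').op s)) = pullbackSection j h s := by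
  have key := Adjunction.unit_leftAdjointUniq_hom_app (Scheme.Modules.restrictAdjunction j)
    (Scheme.Modules.pullbackPushforwardAdjunction j) L
  have key' : ((Scheme.Modules.restrictFunctorIsoPullback j).hom.app L).app (j ⁻¹ᵁ U)
      ((L.restrictAppIso j (j ⁻¹ᵁ U)).inv
        (L.presheaf.map (homOfLE (j.image_preimage_le U)).op s)) = unitSection j L U s :=
    congrArg (fun ψ : L ⟶ (Scheme.Modules.pullback j ⋙ Scheme.Modules.pushforward j).obj L ↦
      Scheme.Modules.Hom.app ψ U s) key
  rw [pullbackSection_apply, ← key', ← app_map]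
  congr 1
  exact (map_map L (homOfLE (j.image_preimage_le U)) (homOfLE (j.image_mono h))
    (homOfLE h') s).symm

theorem isGenerator_restrictAppIso_inv_iff (j : Y ⟶ X) [IsOpenImmersion j] {L : X.Modules}
    {V : Y.Opens} (s : Γ(L, j ''ᵁ V)) :
    IsGenerator ((L.restrictAppIso j V).inv s) ↔ IsGenerator s := by
  have key : ∀ (W : Y.Opens) (h : W ≤ V),
      (Function.Bijective fun r : Γ(Y, W) ↦
        r • (L.restrict j).presheaf.map (homOfLE h).op ((L.restrictAppIso j V).inv s)) ↔
      Function.Bijective fun r : Γ(X, j ''ᵁ W) ↦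
        r • L.presheaf.map (homOfLE (j.image_mono h)).op s := by
    intro W h
    exact Function.Bijective.of_comp_iff (f := fun r : Γ(X, j ''ᵁ W) ↦
        r • L.presheaf.map (homOfLE (j.image_mono h)).op s)
      (ConcreteCategory.bijective_of_isIso (j.appIso W).inv)
  refine ⟨fun H W h ↦ ?_, fun H W h ↦ (key W h).2 (H _ (j.image_mono h))⟩
  -- Every open subset of `j ''ᵁ V` is the image of its preimage, so testing on opens of `Y`
  -- suffices.
  obtain ⟨W, rfl⟩ : ∃ W' : Y.Opens, j ''ᵁ W' = W := ⟨j ⁻¹ᵁ W, by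
    rw [j.image_preimage_eq_opensRange_inf]
    exact inf_eq_right.2 (h.trans (j.image_le_opensRange V))⟩
  have hW : W ≤ V := by
    rw [← j.preimage_image_eq W, ← j.preimage_image_eq V]
    exact j.preimage_mono h
  exact (key W hW).1 (H W hW)

theorem isGenerator_pullbackSection_iff_of_isOpenImmersion (j : Y ⟶ X) [IsOpenImmersion j]
    {L : X.Modules} {U : X.Opens} {V : Y.Opens} (h : V ≤ j ⁻¹ᵁ U) (hV : j ''ᵁ V = U)
    (s : Γ(L, U)) : IsGenerator (pullbackSection j h s) ↔ IsGenerator s := by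
  subst hV
  rw [← restrictFunctorIsoPullback_hom_app_map j h le_rfl, isGenerator_app_iff,
    isGenerator_restrictAppIso_inv_iff, map_self]

/-- The square formed by `f`, its restriction `f ⁻¹ᵁ U ⟶ U` and the two inclusions reduces this to
global generators, as open immersions both preserve and detect generators. -/
theorem IsGenerator.pullbackSection (f : Y ⟶ X) {L : X.Modules} {U : X.Opens} {e : Γ(L, U)}
    (he : IsGenerator e) {V : Y.Opens} (h : V ≤ f ⁻¹ᵁ U) : IsGenerator (pullbackSection f h e) := by
  let W := f ⁻¹ᵁ U
  suffices hW : IsGenerator (FDiv.pullbackSection f (le_refl W) e) by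
    have := hW.map (homOfLE h)
    rwa [map_pullbackSection] at this
  let g := f.resLE U W le_rfl
  have hg : g ≫ U.ι = W.ι ≫ f := f.resLE_comp_ι le_rfl
  have h1 : (⊤ : (U : Scheme.{u}).Opens) ≤ U.ι ⁻¹ᵁ U := by simp
  have h2 : (⊤ : (W : Scheme.{u}).Opens) ≤ W.ι ⁻¹ᵁ W := by simp
  have h3 : (⊤ : (W : Scheme.{u}).Opens) ≤ g ⁻¹ᵁ ⊤ := by simp
  have h4 : (⊤ : (W : Scheme.{u}).Opens) ≤ (g ≫ U.ι) ⁻¹ᵁ U := by simp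
  have h5 : (⊤ : (W : Scheme.{u}).Opens) ≤ (W.ι ≫ f) ⁻¹ᵁ U := by simp [W]
  rw [← isGenerator_pullbackSection_iff_of_isOpenImmersion W.ι h2 (by simp),
    ← isGenerator_app_iff ((Scheme.Modules.pullbackComp W.ι f).hom.app L),
    pullbackComp_hom_app_pullbackSection f W.ι _ _ h5,
    ← pullbackCongr_hom_app_pullbackSection hg h4, isGenerator_app_iff,
    ← pullbackComp_hom_app_pullbackSection U.ι g h1 h3, isGenerator_app_iff]
  refine IsGenerator.pullbackSection_top g ?_ h3
  rwa [isGenerator_pullbackSection_iff_of_isOpenImmersion U.ι h1 (by simp)]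

theorem IsLineBundle.exists_isGenerator {L : X.Modules} (hL : IsLineBundle L) (x : X) :
    ∃ (U : X.Opens) (_ : x ∈ U) (e : Γ(L, U)), IsGenerator e := by
  obtain ⟨U, hxU, ⟨φ⟩⟩ := hL x
  refine ⟨U.ι ''ᵁ ⊤, by simpa using hxU,
    (L.restrictAppIso U.ι ⊤).hom (φ.inv.app ⊤ (oneSection U ⊤)), ?_⟩
  rw [← isGenerator_restrictAppIso_inv_iff]
  have e : (L.restrictAppIso U.ι ⊤).inv ((L.restrictAppIso U.ι ⊤).hom
      (φ.inv.app ⊤ (oneSection U ⊤))) = φ.inv.app ⊤ (oneSection U ⊤) := rfl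
  rw [e, isGenerator_app_iff]
  exact isGenerator_oneSection ⊤

end Generator

/-! ### Frobenius pull-back and functoriality of `PicF` -/

section Frobenius

variable {p : ℕ} [hp : Fact p.Prime] {X Y Z : Scheme.{u}} [IsFpScheme p X] [IsFpScheme p Y]
  [IsFpScheme p Z]

theorem absoluteFrobenius_preimage (U : X.Opens) : absoluteFrobenius p X ⁻¹ᵁ U = U := rfl

/-- This is the source of the exponent in `u_i = a_i * u_{i+1} ^ p`. -/
theorem pullbackSection_absoluteFrobenius_smul {L : X.Modules} {U : X.Opens}
    (h : U ≤ absoluteFrobenius p X ⁻¹ᵁ U) (r : Γ(X, U)) (s : Γ(L, U)) :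
    pullbackSection (absoluteFrobenius p X) h (r • s) =
      r ^ p • pullbackSection (absoluteFrobenius p X) h s := by
  rw [pullbackSection_smul]
  congr 1
  have e : (absoluteFrobenius p X).appLE U U h r = X.presheaf.map (𝟙 (op U)) (r ^ p : Γ(X, U)) :=
    rfl
  rw [e, CategoryTheory.Functor.map_id]
  rfl

theorem pullbackFrobeniusIso_hom_app_pullbackSection (f : Y ⟶ X) {L : X.Modules} {U U' : X.Opens}
    {V V' : Y.Opens} (hU : U' ≤ absoluteFrobenius p X ⁻¹ᵁ U) (hV : V ≤ f ⁻¹ᵁ U')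
    (hU' : V' ≤ f ⁻¹ᵁ U) (hV' : V ≤ absoluteFrobenius p Y ⁻¹ᵁ V') (s : Γ(L, U)) :
    ((FDividedModule.pullbackFrobeniusIso (p := p) f).hom.app L).app V
      (pullbackSection f hV (pullbackSection (absoluteFrobenius p X) hU s)) =
    pullbackSection (absoluteFrobenius p Y) hV' (pullbackSection f hU' s) := by
  have h1 : V ≤ (f ≫ absoluteFrobenius p X) ⁻¹ᵁ U := hV.trans (f.preimage_mono hU)
  have h2 : V ≤ (absoluteFrobenius p Y ≫ f) ⁻¹ᵁ U :=
    hV'.trans ((absoluteFrobenius p Y).preimage_mono hU')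
  have e : (FDividedModule.pullbackFrobeniusIso (p := p) f).hom.app L =
      (Scheme.Modules.pullbackComp f (absoluteFrobenius p X)).hom.app L ≫
        (Scheme.Modules.pullbackCongr (comp_absoluteFrobenius p f)).hom.app L ≫
          (Scheme.Modules.pullbackComp (absoluteFrobenius p Y) f).inv.app L := rfl
  rw [e, comp_app_apply, comp_app_apply,
    ← pullbackComp_inv_app_pullbackSection f (absoluteFrobenius p Y) hU' hV' h2,
    ← pullbackCongr_hom_app_pullbackSection (comp_absoluteFrobenius p f) h1,
    ← pullbackComp_hom_app_pullbackSection (absoluteFrobenius p X) f hU hV h1]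

/-- The pull-back of a morphism `σ : F_X^* L ⟶ M` to a morphism `F_Y^* f^* L ⟶ f^* M`. -/
def pullbackDivision (f : Y ⟶ X) {L M : X.Modules}
    (σ : (Scheme.Modules.pullback (absoluteFrobenius p X)).obj L ⟶ M) :
    (Scheme.Modules.pullback (absoluteFrobenius p Y)).obj ((Scheme.Modules.pullback f).obj L) ⟶
      (Scheme.Modules.pullback f).obj M :=
  (FDividedModule.pullbackFrobeniusIso f).inv.app L ≫ (Scheme.Modules.pullback f).map σ

theorem pullbackDivision_app_pullbackSection (f : Y ⟶ X) {L M : X.Modules}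
    (σ : (Scheme.Modules.pullback (absoluteFrobenius p X)).obj L ⟶ M) {U U' : X.Opens}
    {V V' : Y.Opens} (hU : U' ≤ absoluteFrobenius p X ⁻¹ᵁ U) (hV : V ≤ f ⁻¹ᵁ U')
    (hU' : V' ≤ f ⁻¹ᵁ U) (hV' : V ≤ absoluteFrobenius p Y ⁻¹ᵁ V') (s : Γ(L, U)) :
    (pullbackDivision f σ).app V
      (pullbackSection (absoluteFrobenius p Y) hV' (pullbackSection f hU' s)) =
    pullbackSection f hV (σ.app U' (pullbackSection (absoluteFrobenius p X) hU s)) := by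
  rw [← pullbackFrobeniusIso_hom_app_pullbackSection f hU hV hU' hV',
    ← pullback_map_app_pullbackSection, pullbackDivision, comp_app_apply]
  exact congrArg _ (inv_app_hom_app_apply (FDividedModule.pullbackFrobeniusIso (p := p) f) L V _)

theorem pullback_pullback_hom_ext (f : Y ⟶ X) (g : Z ⟶ Y) {L : X.Modules} {M : Z.Modules}
    {φ ψ : (Scheme.Modules.pullback g).obj ((Scheme.Modules.pullback f).obj L) ⟶ M}
    (h : ∀ (U : X.Opens) (s : Γ(L, U)),
      φ.app (g ⁻¹ᵁ f ⁻¹ᵁ U) (pullbackSection g le_rfl (pullbackSection f le_rfl s)) =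
      ψ.app (g ⁻¹ᵁ f ⁻¹ᵁ U) (pullbackSection g le_rfl (pullbackSection f le_rfl s))) : φ = ψ := by
  rw [← cancel_epi ((Scheme.Modules.pullbackComp g f).inv.app L)]
  refine pullback_hom_ext (g ≫ f) fun U s ↦ ?_
  have := h U s
  have hU : g ⁻¹ᵁ f ⁻¹ᵁ U ≤ (g ≫ f) ⁻¹ᵁ U := le_rfl
  rw [← pullbackComp_inv_app_pullbackSection f g le_rfl le_rfl hU] at this
  exact this

/-- The canonical morphism `(f ∘ g)^* L ⟶ g^* f^* L`. -/
def pullbackCompInv (f : Y ⟶ X) (g : Z ⟶ Y) (L : X.Modules) :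
    (Scheme.Modules.pullback (g ≫ f)).obj L ⟶
      (Scheme.Modules.pullback g).obj ((Scheme.Modules.pullback f).obj L) :=
  (Scheme.Modules.pullbackComp g f).inv.app L

theorem pullbackCompInv_app_pullbackSection (f : Y ⟶ X) (g : Z ⟶ Y) {L : X.Modules} {U : X.Opens}
    {V : Y.Opens} {W : Z.Opens} (hV : V ≤ f ⁻¹ᵁ U) (hW : W ≤ g ⁻¹ᵁ V)
    (hWU : W ≤ (g ≫ f) ⁻¹ᵁ U) (s : Γ(L, U)) :
    (pullbackCompInv f g L).app W (pullbackSection (g ≫ f) hWU s) =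
      pullbackSection g hW (pullbackSection f hV s) :=
  pullbackComp_inv_app_pullbackSection f g hV hW hWU s

/-- Both sides send a twice pulled-back section `s` to the pull-back of `σ (F^* s)`. This is the
coherence that makes `PicF` functorial. -/
theorem pullbackDivision_comp (f : Y ⟶ X) (g : Z ⟶ Y) {L M : X.Modules}
    (σ : (Scheme.Modules.pullback (absoluteFrobenius p X)).obj L ⟶ M) :
    (Scheme.Modules.pullback (absoluteFrobenius p Z)).map (pullbackCompInv f g L) ≫
      pullbackDivision g (pullbackDivision f σ) =
    pullbackDivision (g ≫ f) σ ≫ pullbackCompInv f g M := by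
  refine pullback_pullback_hom_ext (g ≫ f) (absoluteFrobenius p Z) fun U s ↦ ?_
  have h1 : absoluteFrobenius p Z ⁻¹ᵁ (g ≫ f) ⁻¹ᵁ U ≤ (g ≫ f) ⁻¹ᵁ U :=
    (absoluteFrobenius_preimage _).le
  have h2 : (g ≫ f) ⁻¹ᵁ U ≤ g ⁻¹ᵁ f ⁻¹ᵁ U := (Scheme.Hom.comp_preimage g f U).le
  have h3 : f ⁻¹ᵁ U ≤ absoluteFrobenius p Y ⁻¹ᵁ f ⁻¹ᵁ U := (absoluteFrobenius_preimage _).ge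
  have h4 : U ≤ absoluteFrobenius p X ⁻¹ᵁ U := (absoluteFrobenius_preimage _).ge
  have h5 := h1.trans h2
  rw [comp_app_apply, comp_app_apply, pullback_map_app_pullbackSection,
    pullbackCompInv_app_pullbackSection f g le_rfl h2,
    pullbackDivision_app_pullbackSection g _ h3 h5,
    pullbackDivision_app_pullbackSection f _ h4 le_rfl,
    pullbackDivision_app_pullbackSection (g ≫ f) _ h4 h1,
    pullbackCompInv_app_pullbackSection f g le_rfl h5]

namespace FDividedModule

/-- An isomorphism of `F`-divided sheaves from isomorphisms of its terms. -/
def isoMk {A B : FDividedModule p X} (α : ∀ i, A.E i ≅ B.E i)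
    (h : ∀ i, (Scheme.Modules.pullback (absoluteFrobenius p X)).map (α (i + 1)).hom ≫
      (B.σ i).hom = (A.σ i).hom ≫ (α i).hom) : A ≅ B where
  hom := { α := fun i ↦ (α i).hom, comm := h }
  inv :=
    { α := fun i ↦ (α i).inv
      comm := fun i ↦ by
        rw [← cancel_mono (α i).hom, Category.assoc, Category.assoc, ← h i, ← Category.assoc,
          ← Functor.map_comp, Iso.inv_hom_id, Iso.inv_hom_id, CategoryTheory.Functor.map_id,
          Category.id_comp, Category.comp_id] }
  hom_inv_id := Hom.ext (funext fun i ↦ (α i).hom_inv_id)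
  inv_hom_id := Hom.ext (funext fun i ↦ (α i).inv_hom_id)

/-- Pull-back of `F`-divided sheaves along a composition. -/
def pullbackCompIso (f : Y ⟶ X) (g : Z ⟶ Y) (A : FDividedModule p X) :
    (pullback (g ≫ f)).obj A ≅ (pullback g).obj ((pullback f).obj A) :=
  isoMk (fun i ↦ ((Scheme.Modules.pullbackComp g f).symm.app (A.E i) :)) fun i ↦
    pullbackDivision_comp f g (A.σ i).hom

end FDividedModule

theorem PicF.map_comp (f : Y ⟶ X) (g : Z ⟶ Y) (a : PicF p X) :
    PicF.map p (g ≫ f) a = PicF.map p g (PicF.map p f a) := by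
  induction a using Quotient.inductionOn with
  | h A =>
    exact Quotient.sound ⟨ObjectProperty.isoMk _ (FDividedModule.pullbackCompIso f g A.obj)⟩

end Frobenius

/-! ### Descending morphisms along an injective pull-back -/

section Lift

variable {X Y : Scheme.{u}}

theorem section_ext (M : X.Modules) {U : X.Opens} (s t : Γ(M, U))
    (h : ∀ x ∈ U, ∃ (V : X.Opens) (i : V ⟶ U), x ∈ V ∧
      M.presheaf.map i.op s = M.presheaf.map i.op t) : s = t := by
  choose V i hx hst using h
  refine TopCat.Sheaf.eq_of_locally_eq' ⟨M.presheaf, M.isSheaf⟩ (fun x : U ↦ V x.1 x.2) U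
    (fun x ↦ i x.1 x.2) (fun x hxU ↦ Opens.mem_iSup.2 ⟨⟨x, hxU⟩, hx x hxU⟩) s t
    fun x ↦ hst x.1 x.2

/-- Sections of `M` are determined by their pull-backs along `f`. -/
def IsPullbackInjective (f : Y ⟶ X) (M : X.Modules) : Prop :=
  ∀ U : X.Opens, Function.Injective
    (pullbackSection f (le_refl (f ⁻¹ᵁ U)) : Γ(M, U) →+ Γ((Scheme.Modules.pullback f).obj M, _))

theorem IsPullbackInjective.hom_ext {f : Y ⟶ X} {M N : X.Modules} (hM : IsPullbackInjective f M)
    {a b : N ⟶ M} (h : (Scheme.Modules.pullback f).map a = (Scheme.Modules.pullback f).map b) :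
    a = b := by
  ext U s
  apply hM U
  have ha := pullback_map_app_pullbackSection f a (le_refl (f ⁻¹ᵁ U)) s
  have hb := pullback_map_app_pullbackSection f b (le_refl (f ⁻¹ᵁ U)) s
  rw [h] at ha
  exact ha.symm.trans hb

/-- Locally `s = r • e`, so `r • t` is a candidate for the image; injectivity makes the candidates
agree on overlaps, and they glue. -/
theorem IsPullbackInjective.exists_section {f : Y ⟶ X} {L M : X.Modules}
    (hM : IsPullbackInjective f M)
    (φ : (Scheme.Modules.pullback f).obj L ⟶ (Scheme.Modules.pullback f).obj M)
    (h : ∀ x : X, ∃ (V : X.Opens) (_ : x ∈ V) (e : Γ(L, V)) (t : Γ(M, V)), IsGenerator e ∧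
      φ.app (f ⁻¹ᵁ V) (pullbackSection f le_rfl e) = pullbackSection f le_rfl t)
    (U : X.Opens) (s : Γ(L, U)) :
    ∃ t : Γ(M, U), φ.app (f ⁻¹ᵁ U) (pullbackSection f le_rfl s) = pullbackSection f le_rfl t := by
  have hloc : ∀ x ∈ U, ∃ (V : X.Opens) (i : V ⟶ U) (t : Γ(M, V)), x ∈ V ∧
      φ.app (f ⁻¹ᵁ V) (pullbackSection f (f.preimage_mono i.le) s) =
        pullbackSection f le_rfl t := by
    intro x hxU
    obtain ⟨V, hxV, e, t, he, het⟩ := h x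
    obtain ⟨r, hr⟩ := (he (U ⊓ V) inf_le_right).2 (L.presheaf.map (homOfLE inf_le_left).op s)
    refine ⟨U ⊓ V, homOfLE inf_le_left, r • M.presheaf.map (homOfLE inf_le_right).op t,
      ⟨hxU, hxV⟩, ?_⟩
    have het' := congrArg (((Scheme.Modules.pullback f).obj M).presheaf.map
      (homOfLE (f.preimage_mono inf_le_right : f ⁻¹ᵁ (U ⊓ V) ≤ f ⁻¹ᵁ V)).op) het
    rw [← app_map, map_pullbackSection, map_pullbackSection] at het'
    rw [← pullbackSection_map f (homOfLE inf_le_left) le_rfl, ← hr, pullbackSection_smul,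
      pullbackSection_smul, Scheme.Modules.Hom.app_smul, pullbackSection_map, pullbackSection_map,
      het']
  choose V i t hxV ht using hloc
  have ht' : ∀ x hx (W : X.Opens) (j : W ⟶ V x hx),
      pullbackSection f le_rfl (M.presheaf.map j.op (t x hx)) =
        φ.app (f ⁻¹ᵁ W) (pullbackSection f (f.preimage_mono (j.le.trans (i x hx).le)) s) := by
    intro x hx W j
    have := congrArg (((Scheme.Modules.pullback f).obj M).presheaf.map
      (homOfLE (f.preimage_mono j.le)).op) (ht x hx)
    rw [← app_map, map_pullbackSection, map_pullbackSection] at this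
    rw [pullbackSection_map, this]
  obtain ⟨T, hT, -⟩ := TopCat.Sheaf.existsUnique_gluing' ⟨M.presheaf, M.isSheaf⟩
    (fun x : U ↦ V x.1 x.2) U (fun x ↦ i x.1 x.2)
    (fun x hxU ↦ Opens.mem_iSup.2 ⟨⟨x, hxU⟩, hxV x hxU⟩) (fun x ↦ t x.1 x.2) fun x y ↦ by
      apply hM
      exact (ht' x.1 x.2 _ (Opens.infLELeft _ _)).trans (ht' y.1 y.2 _ (Opens.infLERight _ _)).symm
  refine ⟨T, section_ext _ _ _ fun y hy ↦
    ⟨f ⁻¹ᵁ V (f y) hy, homOfLE (f.preimage_mono (i (f y) hy).le), hxV (f y) hy, ?_⟩⟩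
  rw [← app_map, map_pullbackSection, map_pullbackSection, ht (f y) hy]
  have := hT ⟨f y, hy⟩
  dsimp only at this
  rw [← this]
  exact pullbackSection_map f _ _ _

/-- The sections chosen by `exists_section` are unique by injectivity, so the choice is
automatically linear and compatible with restriction. -/
theorem IsPullbackInjective.exists_pullback_map_eq {f : Y ⟶ X} {L M : X.Modules}
    (hM : IsPullbackInjective f M)
    (φ : (Scheme.Modules.pullback f).obj L ⟶ (Scheme.Modules.pullback f).obj M)
    (h : ∀ x : X, ∃ (V : X.Opens) (_ : x ∈ V) (e : Γ(L, V)) (t : Γ(M, V)), IsGenerator e ∧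
      φ.app (f ⁻¹ᵁ V) (pullbackSection f le_rfl e) = pullbackSection f le_rfl t) :
    ∃ α : L ⟶ M, (Scheme.Modules.pullback f).map α = φ := by
  choose t ht using hM.exists_section φ h
  let α : L ⟶ M := homMk
    (fun U ↦
      { toFun := t U
        map_add' a b := hM U (by rw [← ht, map_add, map_add, map_add, ht, ht])
        map_smul' r a := hM U (by
          rw [← ht, RingHom.id_apply, pullbackSection_smul, pullbackSection_smul,
            Scheme.Modules.Hom.app_smul, ht]) })
    fun {U V} hVU s ↦ hM V (by
      have := congrArg (((Scheme.Modules.pullback f).obj M).presheaf.map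
        (homOfLE (f.preimage_mono hVU)).op) (ht U s)
      rw [← app_map, map_pullbackSection, map_pullbackSection] at this
      exact (pullbackSection_map f _ _ _).trans (this.symm.trans
        ((congrArg _ (pullbackSection_map f (homOfLE hVU) le_rfl s).symm).trans (ht V _))))
  refine ⟨α, pullback_hom_ext f fun U s ↦ ?_⟩
  rw [pullback_map_app_pullbackSection, ht]
  rfl

end Lift

/-! ### The generic fibre of a line bundle -/

section GenericPoint

variable (X : Scheme.{u}) [IsIntegral X]

theorem genericPoint_mem {U : X.Opens} {x : X} (hx : x ∈ U) : genericPoint X ∈ U :=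
  ((genericPoint_spec X).mem_open_set_iff U.isOpen).2 ⟨x, trivial, hx⟩

theorem genericPointHom_apply (y : Spec X.functionField) :
    genericPointHom X y = genericPoint X := by
  have : Subsingleton (Spec X.functionField) :=
    inferInstanceAs (Subsingleton (PrimeSpectrum X.functionField))
  rw [Subsingleton.elim y (IsLocalRing.closedPoint X.functionField)]
  exact Scheme.fromSpecStalk_closedPoint

/-- All of `Spec K(X)` maps to the generic point; `x` only witnesses that `U` is non-empty. Hence
sections over `U` can be pulled back to `⊤`. -/
theorem le_genericPointHom_preimage {U : X.Opens} {x : X} (hx : x ∈ U)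
    (V : (Spec X.functionField).Opens) : V ≤ genericPointHom X ⁻¹ᵁ U := fun y _ ↦ by
  change genericPointHom X y ∈ U
  rw [genericPointHom_apply]
  exact genericPoint_mem X hx

/-- The identification of the function field with the functions on its spectrum. -/
def functionFieldEquiv : X.functionField ≃+* Γ(Spec X.functionField, ⊤) :=
  (Scheme.ΓSpecIso X.functionField).symm.commRingCatIsoToRingEquiv

theorem genericPointHom_appLE {U : X.Opens} (hU : genericPoint X ∈ U)
    (h : ⊤ ≤ genericPointHom X ⁻¹ᵁ U) (r : Γ(X, U)) :
    (genericPointHom X).appLE U ⊤ h r =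
      functionFieldEquiv X (X.presheaf.germ U (genericPoint X) hU r) := by
  have : (genericPointHom X).appLE U ⊤ h =
      X.presheaf.germ U (genericPoint X) hU ≫ (Scheme.ΓSpecIso X.functionField).inv := by
    have e : (genericPointHom X).app U = X.presheaf.germ U (genericPoint X) hU ≫
        (Scheme.ΓSpecIso X.functionField).inv ≫
          (Spec X.functionField).presheaf.map (homOfLE le_top).op := Scheme.fromSpecStalk_app hU
    rw [Scheme.Hom.appLE, e, Category.assoc, Category.assoc, ← Functor.map_comp]
    have e' : (Spec X.functionField).presheaf.map ((homOfLE le_top).op ≫ (homOfLE h).op) = 𝟙 _ :=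
      (Spec X.functionField).presheaf.map_id _
    rw [e', Category.comp_id]
  rw [this]
  rfl

variable {X}

/-- Locally `s = r • e`. The pull-back of `e` is still a generator, so the germ of `r` at the
generic point vanishes, and then `r = 0` by integrality. -/
theorem IsLineBundle.isPullbackInjective {M : X.Modules} (hM : IsLineBundle M) :
    IsPullbackInjective (genericPointHom X) M := by
  intro U
  rw [injective_iff_map_eq_zero]
  intro s hs
  refine section_ext _ _ _ fun x hx ↦ ?_
  obtain ⟨V, hxV, e, he⟩ := hM.exists_isGenerator x
  refine ⟨U ⊓ V, homOfLE inf_le_left, ⟨hx, hxV⟩, ?_⟩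
  obtain ⟨r, hr⟩ := (he (U ⊓ V) inf_le_right).2 (M.presheaf.map (homOfLE inf_le_left).op s)
  have hxW : x ∈ U ⊓ V := ⟨hx, hxV⟩
  have hW := le_genericPointHom_preimage X hxW ⊤
  have h0 := congrArg (((Scheme.Modules.pullback (genericPointHom X)).obj M).presheaf.map
    (homOfLE (le_genericPointHom_preimage X hx ⊤)).op) hs
  rw [map_pullbackSection, map_zero] at h0
  have h1 := (pullbackSection_map (genericPointHom X) (homOfLE inf_le_left) hW s).trans h0
  rw [← hr] at h1
  dsimp only at h1
  rw [pullbackSection_smul, genericPointHom_appLE X (genericPoint_mem X hxW)] at h1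
  have hg := ((he.map (homOfLE inf_le_right)).pullbackSection (genericPointHom X) hW) ⊤ le_rfl
  have h2 := hg.1 (a₁ := functionFieldEquiv X
    (X.presheaf.germ (U ⊓ V) (genericPoint X) (genericPoint_mem X hxW) r)) (a₂ := 0) (by
      dsimp only
      rw [map_self, zero_smul]
      exact h1)
  rw [map_eq_zero_iff _ (functionFieldEquiv X).injective] at h2
  have h3 : r = 0 := germ_injective_of_isIntegral X _ (genericPoint_mem X hxW)
    (h2.trans (map_zero _).symm)
  rw [← hr, h3, map_zero]
  exact zero_smul _ _

end GenericPoint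

/-! ### Transition coefficients at a point -/

section Transition

variable {X : Scheme.{u}}

theorem IsGenerator.exists_unit_smul_eq {L : X.Modules} {U : X.Opens} {e e' : Γ(L, U)}
    (he : IsGenerator e) (he' : IsGenerator e') : ∃ c : Γ(X, U)ˣ, (c : Γ(X, U)) • e = e' := by
  have h := he U le_rfl
  have h' := he' U le_rfl
  simp only [map_self] at h h'
  obtain ⟨c, hc⟩ := h.2 e'
  obtain ⟨d, hd⟩ := h'.2 e
  dsimp only at hc hd
  refine ⟨Units.mkOfMulEqOne c d (h'.1 ?_), hc⟩
  dsimp only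
  rw [mul_smul, hd, hc, one_smul]

/-- Both sides evaluate the square `hφ` on the Frobenius pull-back of `f^* s`; one path gives `v ^ p
* d`, the other `c * u`. -/
theorem pullbackDivision_smul_eq {p : ℕ} [Fact p.Prime] {Y : Scheme.{u}} [IsFpScheme p X]
    [IsFpScheme p Y] (f : Y ⟶ X) {L M L' M' : X.Modules}
    (σ : (Scheme.Modules.pullback (absoluteFrobenius p X)).obj L ⟶ L')
    (τ : (Scheme.Modules.pullback (absoluteFrobenius p X)).obj M ⟶ M')
    {φ : (Scheme.Modules.pullback f).obj L ⟶ (Scheme.Modules.pullback f).obj M}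
    {φ' : (Scheme.Modules.pullback f).obj L' ⟶ (Scheme.Modules.pullback f).obj M'}
    (hφ : (Scheme.Modules.pullback (absoluteFrobenius p Y)).map φ ≫ pullbackDivision f τ =
      pullbackDivision f σ ≫ φ')
    {U U' W : X.Opens} {V : Y.Opens} {s : Γ(L, U)} {s' : Γ(M, U)} {e : Γ(L', U')} {e' : Γ(M', U')}
    {u v : Γ(Y, V)} {c d : Γ(X, W)} (hU : V ≤ f ⁻¹ᵁ U) (hU' : V ≤ f ⁻¹ᵁ U') (hV : V ≤ f ⁻¹ᵁ W)
    (hF : W ≤ absoluteFrobenius p X ⁻¹ᵁ U) (i : W ⟶ U')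
    (hu : φ'.app V (pullbackSection f hU' e) = u • pullbackSection f hU' e')
    (hv : φ.app V (pullbackSection f hU s) = v • pullbackSection f hU s')
    (hc : c • L'.presheaf.map i.op e = σ.app W (pullbackSection (absoluteFrobenius p X) hF s))
    (hd : d • M'.presheaf.map i.op e' = τ.app W (pullbackSection (absoluteFrobenius p X) hF s')) :
    (v ^ p * f.appLE W V hV d) • pullbackSection f hU' e' =
      (f.appLE W V hV c * u) • pullbackSection f hU' e' := by
  have hFV : V ≤ absoluteFrobenius p Y ⁻¹ᵁ V := (absoluteFrobenius_preimage V).ge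
  have h1 : ((Scheme.Modules.pullback (absoluteFrobenius p Y)).map φ ≫
      pullbackDivision f τ).app V (pullbackSection (absoluteFrobenius p Y) hFV
        (pullbackSection f hU s)) = (v ^ p * f.appLE W V hV d) • pullbackSection f hU' e' := by
    rw [comp_app_apply, pullback_map_app_pullbackSection, hv,
      pullbackSection_absoluteFrobenius_smul, Scheme.Modules.Hom.app_smul,
      pullbackDivision_app_pullbackSection f τ hF hV, ← hd, pullbackSection_smul,
      pullbackSection_map, mul_smul]
  have h2 : (pullbackDivision f σ ≫ φ').app V (pullbackSection (absoluteFrobenius p Y) hFV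
      (pullbackSection f hU s)) = (f.appLE W V hV c * u) • pullbackSection f hU' e' := by
    rw [comp_app_apply, pullbackDivision_app_pullbackSection f σ hF hV, ← hc, pullbackSection_smul,
      pullbackSection_map, Scheme.Modules.Hom.app_smul, hu, mul_smul]
  rw [← h1, ← h2, hφ]

/-- Naturality of `f^* F_X^* ≅ F_Y^* f^*` lets it be cancelled. Together with
`IsPullbackInjective.hom_ext`, compatibility with the division maps can thus be checked over the
generic point. -/
theorem pullback_map_eq_of_pullbackDivision {p : ℕ} [Fact p.Prime] {Y : Scheme.{u}}
    [IsFpScheme p X] [IsFpScheme p Y] (f : Y ⟶ X) {L M L' M' : X.Modules}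
    {σ : (Scheme.Modules.pullback (absoluteFrobenius p X)).obj L ⟶ L'}
    {τ : (Scheme.Modules.pullback (absoluteFrobenius p X)).obj M ⟶ M'} {a : L ⟶ M} {b : L' ⟶ M'}
    (h : (Scheme.Modules.pullback (absoluteFrobenius p Y)).map ((Scheme.Modules.pullback f).map a) ≫
      pullbackDivision f τ = pullbackDivision f σ ≫ (Scheme.Modules.pullback f).map b) :
    (Scheme.Modules.pullback f).map
        ((Scheme.Modules.pullback (absoluteFrobenius p X)).map a ≫ τ) =
      (Scheme.Modules.pullback f).map (σ ≫ b) := by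
  have h1 := (FDividedModule.pullbackFrobeniusIso (p := p) f).inv.naturality a
  rw [← cancel_epi ((FDividedModule.pullbackFrobeniusIso (p := p) f).inv.app L),
    Functor.map_comp, Functor.map_comp]
  exact ((Category.assoc _ _ _).symm.trans ((congrArg (· ≫ _) h1.symm).trans
    ((Category.assoc _ _ _).trans h))).trans (Category.assoc _ _ _)

theorem IsGenerator.smul_left_injective {L : X.Modules} {U : X.Opens} {e : Γ(L, U)}
    (he : IsGenerator e) {r r' : Γ(X, U)} (h : r • e = r' • e) : r = r' := by
  refine (he U le_rfl).1 ?_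
  dsimp only
  rwa [map_self]

variable [IsIntegral X]

/-- `u` is the coefficient of `φ` with respect to local generators near `x`. -/
def IsTransition {L M : X.Modules} (φ : (Scheme.Modules.pullback (genericPointHom X)).obj L ⟶
    (Scheme.Modules.pullback (genericPointHom X)).obj M) (x : X) (u : X.functionField) : Prop :=
  ∃ (V : X.Opens) (hx : x ∈ V) (e : Γ(L, V)) (e' : Γ(M, V)), IsGenerator e ∧ IsGenerator e' ∧
    φ.app ⊤ (pullbackSection _ (le_genericPointHom_preimage X hx ⊤) e) =
      functionFieldEquiv X u • pullbackSection _ (le_genericPointHom_preimage X hx ⊤) e'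

theorem exists_isTransition {L M : X.Modules} (hL : IsLineBundle L) (hM : IsLineBundle M)
    (φ : (Scheme.Modules.pullback (genericPointHom X)).obj L ⟶
      (Scheme.Modules.pullback (genericPointHom X)).obj M) [IsIso φ] (x : X) :
    ∃ u ≠ 0, IsTransition φ x u := by
  obtain ⟨V, hxV, e, he⟩ := hL.exists_isGenerator x
  obtain ⟨V', hxV', e', he'⟩ := hM.exists_isGenerator x
  have hx : x ∈ V ⊓ V' := ⟨hxV, hxV'⟩
  have hg := he.map (homOfLE (inf_le_left : V ⊓ V' ≤ V))
  have hg' := he'.map (homOfLE (inf_le_right : V ⊓ V' ≤ V'))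
  obtain ⟨c, hc⟩ := (hg'.pullbackSection (genericPointHom X)
    (le_genericPointHom_preimage X hx ⊤)).exists_unit_smul_eq ((isGenerator_app_iff φ).2
      (hg.pullbackSection (genericPointHom X) (le_genericPointHom_preimage X hx ⊤)))
  refine ⟨(functionFieldEquiv X).symm c, ?_, V ⊓ V', hx, _, _, hg, hg', ?_⟩
  · exact (c.isUnit.map (functionFieldEquiv X).symm).ne_zero
  · rw [RingEquiv.apply_symm_apply, hc]

/-- As `σ` and `τ` are isomorphisms, they carry Frobenius pull-backs of generators to generators,
which differ from the chosen ones by units `c` and `d`. Comparing coefficients gives `c * u = v ^ p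
* d`, so `a = d / c`. -/
theorem IsTransition.exists_unit {p : ℕ} [Fact p.Prime] [IsFpScheme p X] {L M L' M' : X.Modules}
    (σ : (Scheme.Modules.pullback (absoluteFrobenius p X)).obj L ≅ L')
    (τ : (Scheme.Modules.pullback (absoluteFrobenius p X)).obj M ≅ M')
    {φ : (Scheme.Modules.pullback (genericPointHom X)).obj L ⟶
      (Scheme.Modules.pullback (genericPointHom X)).obj M}
    {φ' : (Scheme.Modules.pullback (genericPointHom X)).obj L' ⟶
      (Scheme.Modules.pullback (genericPointHom X)).obj M'}
    (hφ : (Scheme.Modules.pullback (absoluteFrobenius p (Spec X.functionField))).map φ ≫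
        pullbackDivision (genericPointHom X) τ.hom =
      pullbackDivision (genericPointHom X) σ.hom ≫ φ')
    {x : X} {u v : X.functionField} (hu : IsTransition φ' x u) (hv : IsTransition φ x v) :
    ∃ a : (X.presheaf.stalk x)ˣ, u = algebraMap _ X.functionField (a : X.presheaf.stalk x) *
      v ^ p := by
  obtain ⟨V, hxV, e, e', he, he', hu⟩ := hu
  obtain ⟨V', hxV', s, s', hs, hs', hv⟩ := hv
  have hx : x ∈ V ⊓ V' := ⟨hxV, hxV'⟩
  have hW : V ⊓ V' ≤ absoluteFrobenius p X ⁻¹ᵁ V' :=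
    inf_le_right.trans (absoluteFrobenius_preimage V').ge
  obtain ⟨c, hc⟩ := (he.map (homOfLE (inf_le_left : V ⊓ V' ≤ V))).exists_unit_smul_eq
    ((isGenerator_app_iff σ.hom).2 (hs.pullbackSection (absoluteFrobenius p X) hW))
  obtain ⟨d, hd⟩ := (he'.map (homOfLE (inf_le_left : V ⊓ V' ≤ V))).exists_unit_smul_eq
    ((isGenerator_app_iff τ.hom).2 (hs'.pullbackSection (absoluteFrobenius p X) hW))
  have hηV := le_genericPointHom_preimage X hxV ⊤
  have key := (he'.pullbackSection (genericPointHom X) hηV).smul_left_injective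
    (pullbackDivision_smul_eq (genericPointHom X) σ.hom τ.hom hφ
      (le_genericPointHom_preimage X hxV' ⊤) hηV (le_genericPointHom_preimage X hx ⊤) hW _
      hu hv hc hd)
  rw [genericPointHom_appLE X (genericPoint_mem X hx),
    genericPointHom_appLE X (genericPoint_mem X hx), ← map_pow, ← map_mul, ← map_mul] at key
  have key' := (functionFieldEquiv X).injective key
  have : Nonempty (V ⊓ V' : X.Opens) := ⟨⟨x, hx⟩⟩
  refine ⟨d.map (X.presheaf.germ _ x hx).hom.toMonoidHom *
    (c.map (X.presheaf.germ _ x hx).hom.toMonoidHom)⁻¹, ?_⟩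
  have h1 : ∀ r : Γ(X, V ⊓ V'), algebraMap (X.presheaf.stalk x) X.functionField
      (X.presheaf.germ _ x hx r) = X.presheaf.germ _ _ (genericPoint_mem X hx) r :=
    fun r ↦ X.algebraMap_germ_eq_germToFunctionField hx r
  have h2 : algebraMap (X.presheaf.stalk x) X.functionField
      ((c.map (X.presheaf.germ _ x hx).hom.toMonoidHom)⁻¹ :) *
        X.presheaf.germ _ _ (genericPoint_mem X hx) c = 1 := by
    rw [← h1, ← map_mul]
    exact (congrArg _ (Units.inv_mul _)).trans (map_one _)
  have h3 : algebraMap (X.presheaf.stalk x) X.functionField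
      (d.map (X.presheaf.germ _ x hx).hom.toMonoidHom :) =
        X.presheaf.germ _ _ (genericPoint_mem X hx) d := h1 d
  rw [Units.val_mul, map_mul, h3]
  linear_combination (-u) * h2 - algebraMap (X.presheaf.stalk x) X.functionField
      ((c.map (X.presheaf.germ _ x hx).hom.toMonoidHom)⁻¹ :) * key'

/-- On a neighbourhood where `a` is the germ of a function `r`, the generator `e` goes to `r • e'`.
This is the local input of `exists_pullback_map_eq`. -/
theorem IsTransition.exists_lift {L M : X.Modules}
    {φ : (Scheme.Modules.pullback (genericPointHom X)).obj L ⟶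
      (Scheme.Modules.pullback (genericPointHom X)).obj M} {x : X} {u : X.functionField}
    (h : IsTransition φ x u) (a : X.presheaf.stalk x) (ha : algebraMap _ X.functionField a = u) :
    ∃ (V : X.Opens) (_ : x ∈ V) (e : Γ(L, V)) (t : Γ(M, V)), IsGenerator e ∧
      φ.app (genericPointHom X ⁻¹ᵁ V) (pullbackSection (genericPointHom X) le_rfl e) =
        pullbackSection (genericPointHom X) le_rfl t := by
  obtain ⟨V, hxV, e, e', he, he', hu⟩ := h
  obtain ⟨V', hxV', r, rfl⟩ := X.presheaf.exists_germ_eq a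
  have hx : x ∈ V ⊓ V' := ⟨hxV, hxV'⟩
  have : Nonempty V' := ⟨⟨x, hxV'⟩⟩
  have h1 : u = X.presheaf.germ V' _ (genericPoint_mem X hxV') r :=
    ha.symm.trans (X.algebraMap_germ_eq_germToFunctionField hxV' r)
  let i : V ⊓ V' ⟶ V := homOfLE inf_le_left
  let i' : V ⊓ V' ⟶ V' := homOfLE inf_le_right
  refine ⟨V ⊓ V', hx, L.presheaf.map i.op e, X.presheaf.map i'.op r • M.presheaf.map i.op e',
    he.map i, ?_⟩
  have hηW := le_genericPointHom_preimage X hx ⊤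
  have key : φ.app ⊤ (pullbackSection (genericPointHom X) hηW
      (L.presheaf.map i.op e)) = pullbackSection (genericPointHom X) hηW
      (X.presheaf.map i'.op r • M.presheaf.map i.op e') := by
    rw [pullbackSection_smul, pullbackSection_map, pullbackSection_map, hu,
      genericPointHom_appLE X (genericPoint_mem X hx), h1]
    congr 2
    exact (X.presheaf.germ_res_apply i' _ _ r).symm
  have := congrArg (((Scheme.Modules.pullback (genericPointHom X)).obj M).presheaf.map
    (homOfLE (le_top : genericPointHom X ⁻¹ᵁ (V ⊓ V') ≤ ⊤)).op) key
  rwa [← app_map, map_pullbackSection, map_pullbackSection] at this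

end Transition

/-! ### Lifting isomorphisms from the generic point -/

section Main

variable {p : ℕ} [hp : Fact p.Prime] {X : Scheme.{u}} [IsFpScheme p X] [IsIntegral X]

theorem FDividedModule.exists_hom_lift [IsNoetherian X] [IsNormalScheme X]
    {A B : FDividedModule p X} (hA : ∀ i, IsLineBundle (A.E i)) (hB : ∀ i, IsLineBundle (B.E i))
    (φ : ∀ i, (Scheme.Modules.pullback (genericPointHom X)).obj (A.E i) ≅
      (Scheme.Modules.pullback (genericPointHom X)).obj (B.E i))
    (hφ : ∀ i, (Scheme.Modules.pullback (absoluteFrobenius p (Spec X.functionField))).map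
        (φ (i + 1)).hom ≫ pullbackDivision (genericPointHom X) (B.σ i).hom =
      pullbackDivision (genericPointHom X) (A.σ i).hom ≫ (φ i).hom) (i : ℕ) :
    ∃ α : A.E i ⟶ B.E i, (Scheme.Modules.pullback (genericPointHom X)).map α = (φ i).hom := by
  refine (hB i).isPullbackInjective.exists_pullback_map_eq (φ i).hom fun x ↦ ?_
  have := IsNormalScheme.isIntegrallyClosed_stalk x
  choose u hu0 hu using fun j ↦ exists_isTransition (hA j) (hB j) (φ j).hom x
  choose a ha using fun j ↦ IsTransition.exists_unit (A.σ j) (B.σ j) (hφ j) (hu j) (hu (j + 1))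
  have hpow : ∀ n : ℕ, ∃ (b : (X.presheaf.stalk x)ˣ) (y : X.functionField),
      u i = algebraMap _ X.functionField (b : X.presheaf.stalk x) * y ^ p ^ n := by
    -- Iterating `u j = a j * u (j + 1) ^ p` shows that the `p ^ n`-th root, up to a unit, is `u (i
    -- + n)`.
    suffices h : ∀ n : ℕ, ∃ b : (X.presheaf.stalk x)ˣ,
        u i = algebraMap _ X.functionField (b : X.presheaf.stalk x) * u (i + n) ^ p ^ n from
      fun n ↦ ⟨_, _, (h n).choose_spec⟩
    intro n
    induction n with
    | zero => exact ⟨1, by simp⟩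
    | succ n ih =>
      obtain ⟨b, hb⟩ := ih
      refine ⟨b * a (i + n) ^ p ^ n, ?_⟩
      rw [hb, ha (i + n), mul_pow, ← pow_mul, ← pow_succ', Units.val_mul, map_mul,
        Units.val_pow_eq_pow_val, map_pow, mul_assoc, add_assoc]
  obtain ⟨b, hb⟩ := exists_unit_of_forall_eq_mul_pow hp.out.one_lt (hu0 i) hpow
  exact (hu i).exists_lift b hb

/-- The components of `Φ` and of its inverse both lift; that the lifts are mutually inverse and
commute with the `σ_i` holds over the generic point, hence on `X`. -/
theorem FDividedModule.nonempty_iso_of_pullback [IsNoetherian X] [IsNormalScheme X]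
    {A B : FDividedModule p X} (hA : ∀ i, IsLineBundle (A.E i)) (hB : ∀ i, IsLineBundle (B.E i))
    (Φ : (pullback (genericPointHom X)).obj A ≅ (pullback (genericPointHom X)).obj B) :
    Nonempty (A ≅ B) := by
  let φ : ∀ i, (Scheme.Modules.pullback (genericPointHom X)).obj (A.E i) ≅
      (Scheme.Modules.pullback (genericPointHom X)).obj (B.E i) := fun i ↦
    { hom := Φ.hom.α i
      inv := Φ.inv.α i
      hom_inv_id := congrFun (congrArg Hom.α Φ.hom_inv_id) i
      inv_hom_id := congrFun (congrArg Hom.α Φ.inv_hom_id) i }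
  have hφ : ∀ i, (Scheme.Modules.pullback (absoluteFrobenius p (Spec X.functionField))).map
        (φ (i + 1)).hom ≫ pullbackDivision (genericPointHom X) (B.σ i).hom =
      pullbackDivision (genericPointHom X) (A.σ i).hom ≫ (φ i).hom := Φ.hom.comm
  choose α hα using exists_hom_lift hA hB φ hφ
  choose β hβ using exists_hom_lift hB hA (fun i ↦ (φ i).symm) Φ.inv.comm
  refine ⟨isoMk (fun i ↦ ⟨α i, β i, (hA i).isPullbackInjective.hom_ext ?_,
    (hB i).isPullbackInjective.hom_ext ?_⟩) fun i ↦ (hB i).isPullbackInjective.hom_ext ?_⟩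
  · rw [Functor.map_comp, hα, hβ, CategoryTheory.Functor.map_id, Iso.symm_hom, Iso.hom_inv_id]
  · rw [Functor.map_comp, hα, hβ, CategoryTheory.Functor.map_id, Iso.symm_hom, Iso.inv_hom_id]
  · refine pullback_map_eq_of_pullbackDivision (genericPointHom X) ?_
    rw [hα, hα]
    exact hφ i

theorem PicF.map_genericPointHom_injective [IsNoetherian X] [IsNormalScheme X] :
    Function.Injective (PicF.map p (genericPointHom X)) := by
  intro a b hab
  induction a using Quotient.inductionOn with
  | h A =>
    induction b using Quotient.inductionOn with
    | h B =>
      obtain ⟨Φ⟩ := Quotient.exact hab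
      obtain ⟨e⟩ := FDividedModule.nonempty_iso_of_pullback A.property B.property
        ((FDividedModule.isLineBundle p _).ι.mapIso Φ)
      exact Quotient.sound ⟨ObjectProperty.isoMk _ e⟩

/-- The generic point of `X` factors through `U`, so restriction to it factors through `PicF p U`.
-/
theorem PicF.map_ι_injective [IsNoetherian X] [IsNormalScheme X] (U : X.Opens)
    (hU : (U : Set X).Nonempty) : Function.Injective (PicF.map p U.ι) := by
  obtain ⟨x, hx⟩ := hU
  intro a b hab
  apply map_genericPointHom_injective
  have h : U.fromSpecStalkOfMem (genericPoint X) (genericPoint_mem X hx) ≫ U.ι =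
      genericPointHom X := U.fromSpecStalkOfMem_ι _ _
  rw [← h, map_comp, map_comp, hab]

end Main

end FDiv

end

theorem proposition3p4 (p : ℕ) [Fact p.Prime] (X : Scheme.{u}) [FDiv.IsFpScheme p X]
    [IsNoetherian X] [FDiv.IsNormalScheme X] [IsIntegral X] :
    Function.Injective (FDiv.PicF.map p (FDiv.genericPointHom X)) ∧
      ∀ U : X.Opens, (U : Set X).Nonempty → Function.Injective (FDiv.PicF.map p U.ι) :=
  ⟨FDiv.PicF.map_genericPointHom_injective, FDiv.PicF.map_ι_injective⟩
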